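/- Let $\Delta$ be a finite reduced crystallographic root system of rank $l$ in a real vector space (for instance the root system of a real split semisimple Lie algebra of rank $l$ with respect to a split Cartan subalgebra), let $\Pi=\{\alpha_1,\dots,\alpha_l\}$ be a numbered system of simple roots, let $W$ be the Weyl group with simple reflections $s_i=s_{\alpha_i}$, and let $C=(C_{j,i})$ be the Cartan matrix, so that $s_i\alpha_j=\alpha_j-C_{j,i}\alpha_i$. For $S\subset\Pi$ let $W_S\subset W$ be the subgroup generated by the $s_i$ with $\alpha_i\in S$. A colored Dynkin diagram with set $S$ of colored vertices is a function $\epsilon:\Pi\to\{\pm1\}$ with $\epsilon_j=1$ for $\alpha_j\notin S$; a vertex $\alpha_i\in S$ is called red if $\epsilon_i=-1$ and blue if $\epsilon_i=1$. Let $\mathbb D(S)$ be the set of these diagrams. For $\alpha_i\in S$ and $D=\epsilon\in\mathbb D(S)$ let $s_iD\in\mathbb D(S)$ be the diagram with signs $\epsilon_j\epsilon_i^{-C_{j,i}}$ at the vertices $\alpha_j\in S$, and let $r_i$ be the number of $\alpha_j\in\Pi\setminus S$ with $C_{j,i}$ odd. The group $W_S$ acts on $\mathbb Z[\mathbb D(S)]$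 by the unique linear action in which $s_i$ sends $D$ to $\epsilon_i^{\,r_i}\,(s_iD)$ for all $\alpha_i\in S$. Put $$\mathcal M(S)=\mathbb Z[W]\otimes_{\mathbb Z[W_S]}\mathbb Z[\mathbb D(S)],\qquad \mathcal M_{l-k}=\bigoplus_{|S|=k}\mathcal M(S).$$ For $D\in\mathbb D(S)$ let $\alpha_{i_1},\dots,\alpha_{i_m}$ ($i_1<\dots<i_m$, $m=l-|S|$) be the uncolored vertices, and for $1\le j\le m$ and $c\in\{1,2\}$ let $\partial_{j,c}D\in\mathbb D(S\cup\{\alpha_{i_j}\})$ be the diagram obtained from $D$ by coloring $\alpha_{i_j}$ red if $c=1$ and blue if $c=2$. Then, for $0\le k<l$, there is exactly one additive map $\partial_{l-k}:\mathcal M_{l-k}\to\mathcal M_{l-k-1}$ such that $$\partial_{l-k}(w\otimes D)=\sum_{j=1}^{l-k}\sum_{c=1}^{2}(-1)^{j+c+1}\,w\otimes\partial_{j,c}D$$ for all $S\subset\Pi$ with $|S|=k$, all $D\in\mathbb D(S)$ and all $w\in W$ of minimal length in the coset $wW_S$. These maps are $\mathbb Z[W]$-linear, and $\partial_{l-k-1}\circ\partial_{l-k}=0$.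 Hence they form a chain complex $\mathcal M_*$ of $\mathbb Z[W]$-modules. -/

import Mathlib

open scoped TensorProduct DirectSum

noncomputable section

namespace ColoredDynkin

section

set_option linter.unusedSectionVars false

variable {ι V V' : Type*} [AddCommGroup V] [Module ℝ V] [AddCommGroup V'] [Module ℝ V']
  {P : RootPairing ι ℝ V V'} [P.IsCrystallographic]
  (b : P.Base) {l : ℕ} (α : Fin l ≃ b.support)

/-! The simple roots are numbered `α₁, …, α_l` by the bijection `α`. A set of simple roots is
a set `S` of numbers. The Weyl group `W` is `P.weylGroup`. -/

/-- The Cartan matrix `C j i`, for which `s_i α_j = α_j - C j i • α_i`. -/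
def cartan (j i : Fin l) : ℤ := b.cartanMatrix (α j) (α i)

/-- The simple reflection `s_i`. -/
def simpleReflection (i : Fin l) : P.weylGroup :=
  RootPairing.weylGroup.ofIdx P (α i : ι)

/-- The group `W_S` generated by the simple reflections with index in `S`. -/
def parabolic (S : Finset (Fin l)) : Subgroup P.weylGroup :=
  Subgroup.closure (simpleReflection b α '' (S : Set (Fin l)))

/-- The generator `s_i` of `W_S`, for `i ∈ S`. -/
def parabolicReflection (S : Finset (Fin l)) (i : S) : parabolic b α S :=
  ⟨simpleReflection b α i, Subgroup.subset_closure ⟨i, i.2, rfl⟩⟩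

/-- The length of `w` with respect to the simple reflections. -/
def length (w : P.weylGroup) : ℕ :=
  sInf {n | ∃ L : List (Fin l), L.length = n ∧ (L.map (simpleReflection b α)).prod = w}

/-- `w` has minimal length in its coset `w W_S`. -/
def IsMinimalRep (S : Finset (Fin l)) (w : P.weylGroup) : Prop :=
  ∀ x ∈ parabolic b α S, length b α w ≤ length b α (w * x)

/-- The set `𝔻(S)` of colored Dynkin diagrams with set `S` of colored vertices. A vertex `i ∈ S` is
red if `ε i = -1` and blue if `ε i = 1`; the sign of an uncolored vertex is `1` by convention. -/
def Diagram (S : Finset (Fin l)) : Type :=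
  {ε : Fin l → ℤˣ // ∀ j ∉ S, ε j = 1}

/-- The diagram `s_i D` for a colored vertex `i`: the sign of a colored vertex `j` becomes
`ε_j * ε_i ^ (-C j i)`. -/
def reflectDiagram {S : Finset (Fin l)} (i : S) (D : Diagram S) : Diagram S :=
  ⟨fun j => if j ∈ S then D.1 j * D.1 i ^ (-cartan b α j i) else 1,
    fun j hj => by simp [hj]⟩

open Classical in
/-- The number `r_i` of uncolored vertices `j` for which `C j i` is odd. -/
def oddCount (S : Finset (Fin l)) (i : S) : ℕ :=
  (Finset.univ.filter fun j : Fin l => j ∉ S ∧ Odd (cartan b α j i)).card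

/-! #### The action of `W_S` on oriented diagrams is well defined -/

lemma smul_mem_rootSpan (w : P.weylGroup) {x : V} (hx : x ∈ P.rootSpan ℤ) :
    w • x ∈ P.rootSpan ℤ := by
  induction hx using Submodule.span_induction with
  | mem y hy =>
    obtain ⟨i, rfl⟩ := hy
    rw [RootPairing.weylGroup_apply_root]
    exact Submodule.subset_span ⟨_, rfl⟩
  | zero => simp
  | add y z _ _ h1 h2 => rw [smul_add]; exact add_mem h1 h2
  | smul n y _ h =>
    rw [smul_comm]
    exact Submodule.smul_mem _ n h

/-- The action of `w` on the root lattice. -/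
def latticeMap (w : P.weylGroup) : P.rootSpan ℤ →ₗ[ℤ] P.rootSpan ℤ :=
  (AddMonoidHom.mk' (fun x : P.rootSpan ℤ => (⟨w • (x : V), smul_mem_rootSpan w x.2⟩ : P.rootSpan ℤ))
    (fun x y => Subtype.ext (smul_add w (x : V) (y : V)))).toIntLinearMap

lemma coe_latticeMap (w : P.weylGroup) (x : P.rootSpan ℤ) :
    (latticeMap w x : V) = w • (x : V) := rfl

/-- The simple roots, as a basis of the root lattice. -/
def simpleBasis : Module.Basis (Fin l) ℤ (P.rootSpan ℤ) :=
  b.toWeightBasisInt.reindex α.symm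

lemma coe_simpleBasis (j : Fin l) : (simpleBasis b α j : V) = P.root (α j) := by
  simp [simpleBasis]

/-- The character of the root lattice with values `ε j` on the simple roots. -/
def character (ε : Fin l → ℤˣ) : P.rootSpan ℤ →ₗ[ℤ] Additive ℤˣ :=
  (simpleBasis b α).constr ℤ fun j => Additive.ofMul (ε j)

lemma character_basis (ε : Fin l → ℤˣ) (j : Fin l) :
    character b α ε (simpleBasis b α j) = Additive.ofMul (ε j) := by
  simp [character]

/-- The action of `W` on all characters of the root lattice. -/
def charAct (w : P.weylGroup) (ε : Fin l → ℤˣ) : Fin l → ℤˣ :=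
  fun j => (character b α ε (latticeMap w⁻¹ (simpleBasis b α j))).toMul

lemma character_charAct (w : P.weylGroup) (ε : Fin l → ℤˣ) :
    character b α (charAct b α w ε) = character b α ε ∘ₗ latticeMap w⁻¹ := by
  refine (simpleBasis b α).ext fun j => ?_
  rw [character_basis]
  rfl

lemma charAct_one (ε : Fin l → ℤˣ) : charAct b α 1 ε = ε := by
  funext j
  have : latticeMap (1 : P.weylGroup)⁻¹ (simpleBasis b α j) = simpleBasis b α j := by
    apply Subtype.ext
    rw [coe_latticeMap, inv_one, one_smul]
  rw [charAct, this, character_basis]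
  rfl

lemma charAct_mul (u w : P.weylGroup) (ε : Fin l → ℤˣ) :
    charAct b α (u * w) ε = charAct b α u (charAct b α w ε) := by
  funext j
  have : latticeMap (u * w)⁻¹ (simpleBasis b α j) =
      latticeMap w⁻¹ (latticeMap u⁻¹ (simpleBasis b α j)) := by
    apply Subtype.ext
    rw [coe_latticeMap, coe_latticeMap, coe_latticeMap, mul_inv_rev, mul_smul]
  rw [charAct, charAct, this, character_charAct]
  rfl

lemma simpleReflection_inv (i : Fin l) :
    (simpleReflection b α i)⁻¹ = simpleReflection b α i :=
  Subtype.ext (RootPairing.Equiv.reflection_inv P _)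

lemma charAct_simple (i j : Fin l) (ε : Fin l → ℤˣ) :
    charAct b α (simpleReflection b α i) ε j = ε j * ε i ^ (-cartan b α j i) := by
  have : latticeMap (simpleReflection b α i)⁻¹ (simpleBasis b α j) =
      simpleBasis b α j + (-cartan b α j i) • simpleBasis b α i := by
    apply Subtype.ext
    rw [coe_latticeMap, simpleReflection_inv]
    simp only [simpleReflection, RootPairing.weylGroup.ofIdx_smul, RootPairing.Equiv.reflection_smul,
      Submodule.coe_add, Submodule.coe_smul, coe_simpleBasis, RootPairing.reflection_apply_root]
    have h : P.pairing (α j) (α i) = ((cartan b α j i : ℤ) : ℝ) := by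
      simp only [cartan, RootPairing.Base.cartanMatrix, RootPairing.Base.cartanMatrixIn_def]
      exact (P.algebraMap_pairingIn ℤ (α j : ι) (α i : ι)).symm
    rw [h, neg_smul, sub_eq_add_neg, Int.cast_smul_eq_zsmul]
  rw [charAct, this, map_add, map_smul, character_basis, character_basis]
  rfl

/-- Forget the signs of the vertices outside `S`. -/
def forget (S : Finset (Fin l)) (ε : Fin l → ℤˣ) : Diagram S :=
  ⟨fun j => if j ∈ S then ε j else 1, fun j hj => by simp [hj]⟩

lemma forget_val {S : Finset (Fin l)} (D : Diagram S) : forget S D.1 = D := by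
  apply Subtype.ext
  funext j
  by_cases hj : j ∈ S
  · simp [forget, hj]
  · simp [forget, hj, D.2 j hj]

/-- The product of the signs of the vertices outside `S`. -/
def outerSign (S : Finset (Fin l)) (ε : Fin l → ℤˣ) : ℤˣ := ∏ j ∈ Sᶜ, ε j

lemma outerSign_val {S : Finset (Fin l)} (D : Diagram S) : outerSign S D.1 = 1 :=
  Finset.prod_eq_one fun j hj => D.2 j (Finset.mem_compl.mp hj)

/-- Forget the outer vertices, but keep the product of their signs as an orientation. -/
def collapse (S : Finset (Fin l)) : ((Fin l → ℤˣ) →₀ ℤ) →ₗ[ℤ] (Diagram S →₀ ℤ) :=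
  Finsupp.lsum ℤ fun ε => ((outerSign S ε : ℤˣ) : ℤ) • Finsupp.lsingle (forget S ε)

lemma collapse_single (S : Finset (Fin l)) (ε : Fin l → ℤˣ) :
    collapse S (Finsupp.single ε 1) =
      Finsupp.single (forget S ε) ((outerSign S ε : ℤˣ) : ℤ) := by
  simp [collapse]

/-- The section of `collapse` that keeps every sign. -/
def spread (S : Finset (Fin l)) : (Diagram S →₀ ℤ) →ₗ[ℤ] ((Fin l → ℤˣ) →₀ ℤ) :=
  Finsupp.lmapDomain ℤ ℤ fun D => D.1

lemma collapse_spread (S : Finset (Fin l)) : collapse S ∘ₗ spread S = LinearMap.id := by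
  refine Finsupp.lhom_ext' fun D => LinearMap.ext_ring ?_
  simp only [LinearMap.comp_apply, Finsupp.lsingle_apply, spread, Finsupp.lmapDomain_apply,
    Finsupp.mapDomain_single, collapse_single, forget_val, outerSign_val, LinearMap.id_apply]
  rfl

/-- The permutation representation of `W` on all characters. -/
def charRep (w : P.weylGroup) : ((Fin l → ℤˣ) →₀ ℤ) →ₗ[ℤ] ((Fin l → ℤˣ) →₀ ℤ) :=
  Finsupp.lmapDomain ℤ ℤ (charAct b α w)

lemma charRep_single (w : P.weylGroup) (ε : Fin l → ℤˣ) (n : ℤ) :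
    charRep b α w (Finsupp.single ε n) = Finsupp.single (charAct b α w ε) n := by
  simp [charRep]

lemma charRep_one : charRep b α (1 : P.weylGroup) = LinearMap.id := by
  refine Finsupp.lhom_ext' fun ε => LinearMap.ext_ring ?_
  simp [charRep_single, charAct_one]

lemma charRep_mul (u w : P.weylGroup) :
    charRep b α (u * w) = charRep b α u ∘ₗ charRep b α w := by
  refine Finsupp.lhom_ext' fun ε => LinearMap.ext_ring ?_
  simp [charRep_single, charAct_mul]

/-- The operator of `s_i` on oriented diagrams. -/
def reflectLin (S : Finset (Fin l)) (i : S) : (Diagram S →₀ ℤ) →ₗ[ℤ] (Diagram S →₀ ℤ) :=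
  Finsupp.lsum ℤ fun D =>
    ((D.1 i ^ oddCount b α S i : ℤˣ) : ℤ) • Finsupp.lsingle (reflectDiagram b α i D)

lemma reflectLin_single (S : Finset (Fin l)) (i : S) (D : Diagram S) (n : ℤ) :
    reflectLin b α S i (Finsupp.single D n) =
      ((D.1 i ^ oddCount b α S i : ℤˣ) : ℤ) • Finsupp.single (reflectDiagram b α i D) n := by
  simp [reflectLin]

lemma zpow_neg_cartan (u : ℤˣ) (n : ℤ) : u ^ (-n) = if Odd n then u else 1 := by
  rcases Int.units_eq_one_or u with rfl | rfl
  · simp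
  · by_cases h : Odd n
    · rw [if_pos h, Odd.neg_one_zpow h.neg]
    · rw [if_neg h, Even.neg_one_zpow (Int.not_odd_iff_even.mp h).neg]

lemma reflectLin_collapse (S : Finset (Fin l)) (i : S) :
    reflectLin b α S i ∘ₗ collapse S = collapse S ∘ₗ charRep b α (simpleReflection b α i) := by
  refine Finsupp.lhom_ext' fun ε => LinearMap.ext_ring ?_
  simp only [LinearMap.comp_apply, Finsupp.lsingle_apply, collapse_single, charRep_single,
    reflectLin_single]
  have h1 : reflectDiagram b α i (forget S ε) =
      forget S (charAct b α (simpleReflection b α i) ε) := by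
    apply Subtype.ext
    funext j
    by_cases hj : j ∈ S
    · simp [reflectDiagram, forget, hj, charAct_simple]
    · simp [reflectDiagram, forget, hj]
  have h2 : outerSign S (charAct b α (simpleReflection b α i) ε) =
      ε i ^ oddCount b α S i * outerSign S ε := by
    simp only [outerSign, charAct_simple, Finset.prod_mul_distrib, zpow_neg_cartan]
    rw [mul_comm, Finset.prod_ite, Finset.prod_const_one, mul_one, Finset.prod_const]
    congr 2
    unfold oddCount
    congr 1
    ext j
    simp
  have h3 : (forget S ε).1 i = ε i := by simp [forget]
  rw [h1, h2, h3, Finsupp.smul_single, smul_eq_mul, Units.val_mul]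

/-- The operator of `w ∈ W_S` on oriented diagrams. -/
def diagramOp (S : Finset (Fin l)) (w : P.weylGroup) :
    (Diagram S →₀ ℤ) →ₗ[ℤ] (Diagram S →₀ ℤ) :=
  collapse S ∘ₗ charRep b α w ∘ₗ spread S

lemma eq_diagramOp {S : Finset (Fin l)} {w : P.weylGroup}
    {T : (Diagram S →₀ ℤ) →ₗ[ℤ] (Diagram S →₀ ℤ)}
    (h : T ∘ₗ collapse S = collapse S ∘ₗ charRep b α w) : T = diagramOp b α S w := by
  rw [diagramOp, ← LinearMap.comp_assoc, ← h, LinearMap.comp_assoc, collapse_spread,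
    LinearMap.comp_id]

lemma diagramOp_collapse (S : Finset (Fin l)) (w : P.weylGroup) (hw : w ∈ parabolic b α S) :
    diagramOp b α S w ∘ₗ collapse S = collapse S ∘ₗ charRep b α w := by
  suffices h : ∃ T : (Diagram S →₀ ℤ) →ₗ[ℤ] (Diagram S →₀ ℤ),
      T ∘ₗ collapse S = collapse S ∘ₗ charRep b α w by
    obtain ⟨T, hT⟩ := h
    rw [← eq_diagramOp b α hT, hT]
  induction hw using Subgroup.closure_induction'' with
  | mem x hx =>
    obtain ⟨i, hi, rfl⟩ := hx
    exact ⟨_, reflectLin_collapse b α S ⟨i, hi⟩⟩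
  | inv_mem x hx =>
    obtain ⟨i, hi, rfl⟩ := hx
    rw [simpleReflection_inv]
    exact ⟨_, reflectLin_collapse b α S ⟨i, hi⟩⟩
  | one => exact ⟨LinearMap.id, by rw [charRep_one, LinearMap.id_comp, LinearMap.comp_id]⟩
  | mul x y _ _ hx hy =>
    obtain ⟨T, hT⟩ := hx
    obtain ⟨U, hU⟩ := hy
    refine ⟨T ∘ₗ U, ?_⟩
    rw [LinearMap.comp_assoc, hU, ← LinearMap.comp_assoc, hT, LinearMap.comp_assoc, charRep_mul]

lemma diagramOp_one (S : Finset (Fin l)) : diagramOp b α S 1 = LinearMap.id := by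
  rw [diagramOp, charRep_one, LinearMap.id_comp, collapse_spread]

lemma diagramOp_mul (S : Finset (Fin l)) (u w : P.weylGroup) (hu : u ∈ parabolic b α S)
    (hw : w ∈ parabolic b α S) :
    diagramOp b α S (u * w) = diagramOp b α S u ∘ₗ diagramOp b α S w := by
  refine (eq_diagramOp b α ?_).symm
  rw [LinearMap.comp_assoc, diagramOp_collapse b α S w hw, ← LinearMap.comp_assoc,
    diagramOp_collapse b α S u hu, LinearMap.comp_assoc, charRep_mul]

lemma diagramOp_simple (S : Finset (Fin l)) (i : S) :
    diagramOp b α S (simpleReflection b α i) = reflectLin b α S i :=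
  (eq_diagramOp b α (reflectLin_collapse b α S i)).symm

/-- There is exactly one linear action of `W_S` on `ℤ[𝔻(S)]` for which
`s_i D = (ε_i) ^ r_i • (s_i D)` for all colored vertices `i` and all diagrams `D`. -/
theorem existsUnique_diagramRep (S : Finset (Fin l)) :
    ∃! ρ : Representation ℤ (parabolic b α S) (Diagram S →₀ ℤ),
      ∀ (i : S) (D : Diagram S),
        ρ (parabolicReflection b α S i) (Finsupp.single D 1) =
          ((D.1 i ^ oddCount b α S i : ℤˣ) : ℤ) • Finsupp.single (reflectDiagram b α i D) 1 := by
  refine ⟨{ toFun := fun w => diagramOp b α S w.1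
            map_one' := diagramOp_one b α S
            map_mul' := fun u w => diagramOp_mul b α S u.1 w.1 u.2 w.2 }, ?_, ?_⟩
  · intro i D
    change diagramOp b α S (simpleReflection b α i) _ = _
    rw [diagramOp_simple, reflectLin_single]
  · intro ρ hρ
    have gen : ∀ i : S, ρ (parabolicReflection b α S i) =
        diagramOp b α S (simpleReflection b α i) := by
      intro i
      rw [diagramOp_simple]
      refine Finsupp.lhom_ext' fun D => LinearMap.ext_ring ?_
      simp only [LinearMap.comp_apply, Finsupp.lsingle_apply, reflectLin_single]
      exact hρ i D
    have key : ∀ w (hw : w ∈ parabolic b α S), ρ ⟨w, hw⟩ = diagramOp b α S w := by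
      intro w hw
      induction hw using Subgroup.closure_induction'' with
      | mem x hx =>
        obtain ⟨i, hi, rfl⟩ := hx
        exact gen ⟨i, hi⟩
      | inv_mem x hx =>
        obtain ⟨i, hi, rfl⟩ := hx
        simp only [simpleReflection_inv]
        exact gen ⟨i, hi⟩
      | one =>
        rw [diagramOp_one]
        exact map_one ρ
      | mul x y hx hy h1 h2 =>
        rw [diagramOp_mul b α S x y hx hy, ← h1, ← h2]
        exact map_mul ρ ⟨x, hx⟩ ⟨y, hy⟩
    exact MonoidHom.ext fun w => key w.1 w.2

/-- The `W_S`-module `ℤ[𝔻(S)]`. An oriented diagram `(D, o)` is the element `o • D`, and `s_i` sends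
`(D, o)` to `(s_i D, (ε_i) ^ r_i * o)`. -/
def diagramRep (S : Finset (Fin l)) :
    Representation ℤ (parabolic b α S) (Diagram S →₀ ℤ) :=
  (existsUnique_diagramRep b α S).choose

/-! #### The induced modules and the boundary maps -/

/-- The relations `(a * y) ⊗ x = a ⊗ (y • x)`, for `y ∈ ℤ[W_S]`, in `ℤ[W] ⊗_ℤ ℤ[𝔻(S)]`. -/
def balancing (S : Finset (Fin l)) :
    Submodule (MonoidAlgebra ℤ P.weylGroup)
      (MonoidAlgebra ℤ P.weylGroup ⊗[ℤ] (Diagram S →₀ ℤ)) :=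
  Submodule.span _ {z | ∃ (a : MonoidAlgebra ℤ P.weylGroup)
    (y : MonoidAlgebra ℤ (parabolic b α S)) (x : Diagram S →₀ ℤ),
    z = (a * MonoidAlgebra.mapDomainRingHom ℤ (parabolic b α S).subtype y) ⊗ₜ[ℤ] x
      - a ⊗ₜ[ℤ] ((diagramRep b α S).asAlgebraHom y x)}

/-- The `ℤ[W]`-module `𝓜(S) = ℤ[W] ⊗_{ℤ[W_S]} ℤ[𝔻(S)]`. -/
def InducedModule (S : Finset (Fin l)) : Type _ :=
  (MonoidAlgebra ℤ P.weylGroup ⊗[ℤ] (Diagram S →₀ ℤ)) ⧸ balancing b α S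

instance (S : Finset (Fin l)) : AddCommGroup (InducedModule b α S) :=
  Submodule.Quotient.addCommGroup (balancing b α S)

instance (S : Finset (Fin l)) : Module (MonoidAlgebra ℤ P.weylGroup) (InducedModule b α S) :=
  Submodule.Quotient.module (balancing b α S)

/-- The element `w ⊗ x` of `𝓜(S)`, for `w ∈ W`. -/
def tensor (S : Finset (Fin l)) (w : P.weylGroup) (x : Diagram S →₀ ℤ) : InducedModule b α S :=
  (balancing b α S).mkQ (MonoidAlgebra.of ℤ P.weylGroup w ⊗ₜ[ℤ] x)

/-- The sets of simple roots with exactly `n` elements in their complement. -/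
abbrev SubsetOf (l n : ℕ) : Type := {S : Finset (Fin l) // S.card + n = l}

/-- The `ℤ[W]`-module `𝓜_n`, the direct sum of the `𝓜(S)` over all `S` with `|S| = l - n`.
It is zero for `n > l`. -/
abbrev Chains (n : ℕ) : Type _ := ⨁ S : SubsetOf l n, InducedModule b α S.1

/-- The element `w ⊗ x` of the summand `𝓜(S)` of `𝓜_n`. -/
def chain {n : ℕ} (S : SubsetOf l n) (w : P.weylGroup) (x : Diagram S.1 →₀ ℤ) : Chains b α n :=
  DirectSum.of (fun S : SubsetOf l n => InducedModule b α S.1) S (tensor b α S.1 w x)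

/-- Color the vertex `j` red if `c = 1` and blue otherwise. -/
def colorVertex {S : Finset (Fin l)} (j : Fin l) (c : ℕ) (D : Diagram S) : Diagram (insert j S) :=
  ⟨Function.update D.1 j (if c = 1 then -1 else 1), fun k hk => by
    rw [Finset.mem_insert, not_or] at hk
    rw [Function.update_of_ne hk.1]
    exact D.2 k hk.2⟩

/-- The position (counted from `1`) of the vertex `j` among the uncolored vertices. -/
def position (S : Finset (Fin l)) (j : Fin l) : ℕ := (Sᶜ.filter fun i => i ≤ j).card

/-- The set `S ∪ {j}`, for an uncolored vertex `j`. -/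
def colorSet {n : ℕ} (S : SubsetOf l (n + 1)) (j : Fin l) (hj : j ∉ S.1) : SubsetOf l n :=
  ⟨insert j S.1, by rw [Finset.card_insert_of_notMem hj]; have := S.2; omega⟩

/-- The maps `d n : 𝓜_{n+1} → 𝓜_n` are the signed boundary maps: on `w ⊗ D`, with `D` a colored
diagram and `w` of minimal length in `w W_S`,
`d (w ⊗ D) = ∑_j ∑_{c = 1, 2} (-1) ^ (j + c + 1) • w ⊗ ∂_{j,c} D`, where the sum is over the
uncolored vertices, `j` stands in the exponent for the position of the vertex among them, and
`∂_{j,c}` colors that vertex red (`c = 1`) or blue (`c = 2`). -/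
def IsSignedBoundary (d : ∀ n : ℕ, Chains b α (n + 1) →+ Chains b α n) : Prop :=
  ∀ (n : ℕ) (S : SubsetOf l (n + 1)) (w : P.weylGroup), IsMinimalRep b α S.1 w →
    ∀ D : Diagram S.1,
      d n (chain b α S w (Finsupp.single D 1)) =
        ∑ j : {j : Fin l // j ∉ S.1}, ∑ c ∈ ({1, 2} : Finset ℕ),
          (-1 : ℤ) ^ (position S.1 j + c + 1) •
            chain b α (colorSet S j j.2) w (Finsupp.single (colorVertex j.1 c D) 1)

end

end ColoredDynkin

end

noncomputable section

namespace ColoredDynkin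

set_option linter.unusedSectionVars false

variable {ι V V' : Type*} [AddCommGroup V] [Module ℝ V] [AddCommGroup V'] [Module ℝ V']
  {P : RootPairing ι ℝ V V'} [P.IsCrystallographic]
  (b : P.Base) {l : ℕ} (α : Fin l ≃ b.support)

/-! The heart of the matter is that the red-minus-blue difference `colorDiff S j` commutes with
every $s_i$, $\alpha_i\in S$ (`colorDiff_reflection`). If $\epsilon_i^{-C_{j,i}}=-1$, then $s_i$
exchanges red and blue at the new vertex $j$ and negates the difference. In exactly that case the
factor $\epsilon_i^{r_i}$ also changes sign, because $j$ leaves the count $r_i$ when it is colored.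

Hence the signed sum `boundaryGen` of these differences is $W_S$-equivariant, and the universal
property of the induced module extends it to a $\mathbb Z[W]$-linear map `boundary`. This map
satisfies the required formula for every $w$, not only for minimal ones (`boundary_chain`).

Uniqueness holds because $w\otimes x=wu\otimes u^{-1}x$ for $u\in W_S$: the tensors with $w$ minimal
in its coset already generate additively (`addHom_ext_of_isMinimalRep`). The square vanishes by the
simplicial argument: coloring two vertices in either order gives the same diagram with opposite
signs (`neg_one_pow_position_swap`). -/

lemma diagramRep_single (S : Finset (Fin l)) (i : S) (D : Diagram S) :
    diagramRep b α S (parabolicReflection b α S i) (Finsupp.single D 1) =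
      ((D.1 i ^ oddCount b α S i : ℤˣ) : ℤ) • Finsupp.single (reflectDiagram b α i D) 1 :=
  (existsUnique_diagramRep b α S).choose_spec.1 i D

/-! ### Generators of the induced module -/

lemma tensor_add (S : Finset (Fin l)) (w : P.weylGroup) (x y : Diagram S →₀ ℤ) :
    tensor b α S w (x + y) = tensor b α S w x + tensor b α S w y := by
  rw [tensor, TensorProduct.tmul_add, map_add]
  rfl

/-- The additive map `x ↦ w ⊗ x`. -/
def tensorHom (S : Finset (Fin l)) (w : P.weylGroup) :
    (Diagram S →₀ ℤ) →+ InducedModule b α S :=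
  AddMonoidHom.mk' (tensor b α S w) (tensor_add b α S w)

lemma of_smul_tensor (S : Finset (Fin l)) (u w : P.weylGroup) (x : Diagram S →₀ ℤ) :
    MonoidAlgebra.of ℤ P.weylGroup u • tensor b α S w x = tensor b α S (u * w) x := by
  rw [tensor, tensor, map_mul, ← smul_eq_mul, ← TensorProduct.smul_tmul']
  exact ((balancing b α S).mkQ.map_smul _ _).symm

lemma tensor_mul (S : Finset (Fin l)) (w : P.weylGroup) (u : parabolic b α S)
    (x : Diagram S →₀ ℤ) :
    tensor b α S (w * u) x = tensor b α S w (diagramRep b α S u x) := by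
  have h : (MonoidAlgebra.of ℤ P.weylGroup w *
        MonoidAlgebra.mapDomainRingHom ℤ (parabolic b α S).subtype (MonoidAlgebra.of ℤ _ u)) ⊗ₜ[ℤ] x
      - MonoidAlgebra.of ℤ P.weylGroup w ⊗ₜ[ℤ]
        ((diagramRep b α S).asAlgebraHom (MonoidAlgebra.of ℤ _ u) x) ∈ balancing b α S :=
    Submodule.subset_span ⟨_, _, _, rfl⟩
  rw [Representation.asAlgebraHom_of, MonoidAlgebra.of_apply _ (parabolic b α S),
    MonoidAlgebra.mapDomainRingHom_apply, MonoidAlgebra.mapDomain_single] at h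
  rw [tensor, map_mul]
  exact (Submodule.Quotient.eq _).mpr h

/-- Every coset of a parabolic subgroup contains an element of minimal length. -/
lemma exists_isMinimalRep (S : Finset (Fin l)) (w : P.weylGroup) :
    ∃ u : parabolic b α S, IsMinimalRep b α S (w * u) := by
  have hne : (Set.range fun u : parabolic b α S => length b α (w * u)).Nonempty :=
    Set.range_nonempty _
  obtain ⟨u, hu⟩ := Nat.sInf_mem hne
  refine ⟨u, fun x hx => ?_⟩
  have hle := Nat.sInf_le (Set.mem_range_self (f := fun u : parabolic b α S => length b α (w * u))
    (u * ⟨x, hx⟩))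
  rw [← hu, Subgroup.coe_mul, ← mul_assoc] at hle
  exact hle

/-- Additive maps on `𝓜(S)` that agree on `w ⊗ D` for minimal `w` are equal. -/
lemma addHom_ext_of_isMinimalRep {A : Type*} [AddCommGroup A] (S : Finset (Fin l))
    {f g : InducedModule b α S →+ A}
    (h : ∀ w, IsMinimalRep b α S w → ∀ D,
      f (tensor b α S w (Finsupp.single D 1)) = g (tensor b α S w (Finsupp.single D 1))) :
    f = g := by
  have minimal (w : P.weylGroup) (hw : IsMinimalRep b α S w) :
      f.comp (tensorHom b α S w) = g.comp (tensorHom b α S w) :=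
    Finsupp.addHom_ext' fun D => AddMonoidHom.ext_int (h w hw D)
  have all (w : P.weylGroup) (x : Diagram S →₀ ℤ) :
      f (tensor b α S w x) = g (tensor b α S w x) := by
    obtain ⟨u, hu⟩ := exists_isMinimalRep b α S w
    -- The element of $W_S$ that makes $w$ minimal is compensated in the second factor.
    have hx : tensor b α S w x = tensor b α S (w * u) (diagramRep b α S u⁻¹ x) := by
      rw [← tensor_mul, Subgroup.coe_inv, mul_inv_cancel_right]
    rw [hx]
    exact DFunLike.congr_fun (minimal _ hu) _
  ext z
  obtain ⟨t, rfl⟩ := (balancing b α S).mkQ_surjective z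
  induction t using TensorProduct.induction_on with
  | zero => rw [map_zero]; exact (map_zero f).trans (map_zero g).symm
  | add t u ht hu =>
    rw [map_add]
    exact (map_add f _ _).trans ((congrArg₂ (· + ·) ht hu).trans (map_add g _ _).symm)
  | tmul a x =>
    induction a using MonoidAlgebra.induction_on generalizing x with
    | of w => exact all w x
    | add a c ha hc =>
      rw [TensorProduct.add_tmul, map_add]
      exact (map_add f _ _).trans ((congrArg₂ (· + ·) (ha x) (hc x)).trans (map_add g _ _).symm)
    | smul n a ha =>
      -- The integer moves into the second factor, so the induction has to hold for all `x`.
      rw [TensorProduct.smul_tmul]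
      exact ha _

/-! ### Equivariance of the red-minus-blue difference -/

/-- The difference of the two colorings of the vertex `j`. -/
def colorDiff (S : Finset (Fin l)) (j : Fin l) :
    (Diagram S →₀ ℤ) →ₗ[ℤ] (Diagram (insert j S) →₀ ℤ) :=
  Finsupp.lmapDomain ℤ ℤ (colorVertex j 1) - Finsupp.lmapDomain ℤ ℤ (colorVertex j 2)

lemma colorDiff_single (S : Finset (Fin l)) (j : Fin l) (D : Diagram S) (n : ℤ) :
    colorDiff S j (Finsupp.single D n) =
      Finsupp.single (colorVertex j 1 D) n - Finsupp.single (colorVertex j 2 D) n := by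
  simp [colorDiff]

/-- Coloring $j$ removes it from the uncolored vertices that $r_i$ counts. -/
lemma oddCount_insert {S : Finset (Fin l)} {j : Fin l} (hj : j ∉ S) (i : S) :
    oddCount b α S i = oddCount b α (insert j S) ⟨i, Finset.mem_insert_of_mem i.2⟩ +
      if Odd (cartan b α j i) then 1 else 0 := by
  classical
  unfold oddCount
  split_ifs with h
  · rw [← Finset.card_insert_of_notMem (a := j) (by simp)]
    congr 1
    ext k
    by_cases hk : k = j
    · simp [hk, hj, h]
    · simp [hk]
  · rw [add_zero]
    congr 1
    ext k
    by_cases hk : k = j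
    · simp [hk, h]
    · simp [hk]

lemma reflectDiagram_colorVertex {S : Finset (Fin l)} {j : Fin l} (hj : j ∉ S) (i : S) (c : ℕ)
    (D : Diagram S) (hD : D.1 i ^ (-cartan b α j i) = 1) :
    reflectDiagram b α ⟨i, Finset.mem_insert_of_mem i.2⟩ (colorVertex j c D) =
      colorVertex j c (reflectDiagram b α i D) := by
  have hij : (i : Fin l) ≠ j := fun h => hj (h ▸ i.2)
  apply Subtype.ext
  funext k
  by_cases hk : k = j
  · subst hk
    simp [reflectDiagram, colorVertex, Function.update_of_ne hij, -zpow_neg, hD]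
  · simp [reflectDiagram, colorVertex, Function.update_of_ne hij, hk]

/-- The hypothesis `hc` makes `c` and `c'` opposite colors: here $s_i$ flips the sign at $j$. -/
lemma reflectDiagram_colorVertex_neg {S : Finset (Fin l)} {j : Fin l} (hj : j ∉ S) (i : S)
    {c c' : ℕ} (hc : c = 1 ↔ ¬ c' = 1)
    (D : Diagram S) (hD : D.1 i ^ (-cartan b α j i) = -1) :
    reflectDiagram b α ⟨i, Finset.mem_insert_of_mem i.2⟩ (colorVertex j c D) =
      colorVertex j c' (reflectDiagram b α i D) := by
  have hij : (i : Fin l) ≠ j := fun h => hj (h ▸ i.2)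
  apply Subtype.ext
  funext k
  by_cases hk : k = j
  · subst hk
    by_cases h : c' = 1 <;> simp [reflectDiagram, colorVertex, Function.update_of_ne hij,
      -zpow_neg, hD, hc, h]
  · simp [reflectDiagram, colorVertex, Function.update_of_ne hij, hk]

/-- The sign $\epsilon_i^{-C_{j,i}}$ enters twice, once through the color of $j$ and once through
the change of $r_i$, and the two effects cancel. -/
lemma colorDiff_reflection {S : Finset (Fin l)} {j : Fin l} (hj : j ∉ S) (i : S)
    (x : Diagram S →₀ ℤ) :
    colorDiff S j (diagramRep b α S (parabolicReflection b α S i) x) =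
      diagramRep b α (insert j S)
        (parabolicReflection b α (insert j S) ⟨i, Finset.mem_insert_of_mem i.2⟩)
        (colorDiff S j x) := by
  suffices h : colorDiff S j ∘ₗ diagramRep b α S (parabolicReflection b α S i) =
      diagramRep b α (insert j S)
        (parabolicReflection b α (insert j S) ⟨i, Finset.mem_insert_of_mem i.2⟩) ∘ₗ
        colorDiff S j from DFunLike.congr_fun h x
  refine Finsupp.lhom_ext' fun D => LinearMap.ext_ring ?_
  have hij : (i : Fin l) ≠ j := fun h => hj (h ▸ i.2)
  have hval (c : ℕ) : (colorVertex j c D).1 i = D.1 i := Function.update_of_ne hij _ _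
  simp only [LinearMap.comp_apply, Finsupp.lsingle_apply, diagramRep_single, map_smul,
    colorDiff_single, map_sub, hval, oddCount_insert b α hj i]
  rw [← smul_sub]
  by_cases hD : D.1 i ^ (-cartan b α j i) = 1
  -- Powers of a sign depend only on the parity of the exponent, so the contribution of $j$ to
  -- $\epsilon_i^{r_i}$ equals $\epsilon_i^{-C_{j,i}}$.
  · have hsign : D.1 i ^ (if Odd (cartan b α j i) then 1 else 0) = 1 := by
      exact (by rw [zpow_neg_cartan]; split_ifs <;> simp : _ = _).trans hD
    rw [reflectDiagram_colorVertex b α hj i 1 D hD, reflectDiagram_colorVertex b α hj i 2 D hD,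
      pow_add, hsign, mul_one]
  · replace hD := (Int.units_eq_one_or _).resolve_left hD
    have hsign : D.1 i ^ (if Odd (cartan b α j i) then 1 else 0) = -1 := by
      exact (by rw [zpow_neg_cartan]; split_ifs <;> simp : _ = _).trans hD
    rw [reflectDiagram_colorVertex_neg b α hj i (c := 1) (c' := 2) (by simp) D hD,
      reflectDiagram_colorVertex_neg b α hj i (c := 2) (c' := 1) (by simp) D hD,
      pow_add, hsign, mul_neg_one, Units.val_neg, neg_smul, ← smul_neg, neg_sub]

/-! ### Construction of the boundary maps -/

lemma of_smul_chain {n : ℕ} (S : SubsetOf l n) (u w : P.weylGroup) (x : Diagram S.1 →₀ ℤ) :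
    MonoidAlgebra.of ℤ P.weylGroup u • chain b α S w x = chain b α S (u * w) x := by
  rw [chain, chain, ← of_smul_tensor]
  exact ((DirectSum.lof (MonoidAlgebra ℤ P.weylGroup) _
    (fun T : SubsetOf l n => InducedModule b α T.1) S).map_smul _ _).symm

/-- `colorVertex` with values in the diagrams on `colorSet`. -/
def colorDiagram {n : ℕ} (S : SubsetOf l (n + 1)) (j : {j : Fin l // j ∉ S.1}) (c : ℕ)
    (D : Diagram S.1) : Diagram (colorSet S j j.2).1 :=
  colorVertex j.1 c D

/-- The element `w ⊗ x` of the summand `𝓜(S)` of `𝓜_n`, as an additive map in `x`. -/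
def chainHom {n : ℕ} (S : SubsetOf l n) (w : P.weylGroup) :
    (Diagram S.1 →₀ ℤ) →+ Chains b α n :=
  (DirectSum.of (fun T : SubsetOf l n => InducedModule b α T.1) S).comp (tensorHom b α S.1 w)

lemma chainHom_apply {n : ℕ} (S : SubsetOf l n) (w : P.weylGroup) (x : Diagram S.1 →₀ ℤ) :
    chainHom b α S w x = chain b α S w x := rfl

/-- `colorDiff` with values in the diagrams on `colorSet`. -/
def colorDiffHom {n : ℕ} (S : SubsetOf l (n + 1)) (j : {j : Fin l // j ∉ S.1}) :
    (Diagram S.1 →₀ ℤ) →+ (Diagram (colorSet S j j.2).1 →₀ ℤ) :=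
  (colorDiff S.1 j.1).toAddMonoidHom

lemma colorDiffHom_single {n : ℕ} (S : SubsetOf l (n + 1)) (j : {j : Fin l // j ∉ S.1})
    (D : Diagram S.1) (m : ℤ) :
    colorDiffHom S j (Finsupp.single D m) =
      Finsupp.single (colorDiagram S j 1 D) m - Finsupp.single (colorDiagram S j 2 D) m :=
  colorDiff_single S.1 j.1 D m

lemma chain_colorDiffHom_reflection {n : ℕ} (S : SubsetOf l (n + 1)) (j : {j : Fin l // j ∉ S.1})
    (w : P.weylGroup) (i : S.1) (x : Diagram S.1 →₀ ℤ) :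
    chain b α (colorSet S j j.2) w
        (colorDiffHom S j (diagramRep b α S.1 (parabolicReflection b α S.1 i) x)) =
      chain b α (colorSet S j j.2) (w * simpleReflection b α i) (colorDiffHom S j x) :=
  congrArg (DirectSum.of (fun T : SubsetOf l n => InducedModule b α T.1) (colorSet S j j.2)) <|
    (congrArg (tensor b α (insert j.1 S.1) w) (colorDiff_reflection b α j.2 i x)).trans
      (tensor_mul b α (insert j.1 S.1) w
        (parabolicReflection b α (insert j.1 S.1) ⟨i, Finset.mem_insert_of_mem i.2⟩)
        (colorDiff S.1 j.1 x)).symm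

/-- The signed sum of all colorings of one uncolored vertex, as an element of `𝓜_n`. -/
def boundaryGen {n : ℕ} (S : SubsetOf l (n + 1)) : (Diagram S.1 →₀ ℤ) →+ Chains b α n :=
  ∑ j : {j : Fin l // j ∉ S.1}, (-1 : ℤ) ^ position S.1 j •
    (chainHom b α (colorSet S j j.2) 1).comp (colorDiffHom S j)

lemma boundaryGen_apply {n : ℕ} (S : SubsetOf l (n + 1)) (x : Diagram S.1 →₀ ℤ) :
    boundaryGen b α S x = ∑ j : {j : Fin l // j ∉ S.1}, (-1 : ℤ) ^ position S.1 j •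
      chain b α (colorSet S j j.2) 1 (colorDiffHom S j x) := by
  simp only [boundaryGen, AddMonoidHom.finsetSum_apply]
  rfl

/-- Since $i$ stays colored when $j$ is colored, $s_i$ also lies in $W_{S\cup\{j\}}$ and can cross
the tensor sign in each target summand. Generators of $W_S$ suffice. -/
lemma boundaryGen_diagramRep {n : ℕ} (S : SubsetOf l (n + 1)) (u : parabolic b α S.1)
    (x : Diagram S.1 →₀ ℤ) :
    boundaryGen b α S (diagramRep b α S.1 u x) =
      MonoidAlgebra.of ℤ P.weylGroup u • boundaryGen b α S x := by
  have refl (i : S.1) (x : Diagram S.1 →₀ ℤ) :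
      boundaryGen b α S (diagramRep b α S.1 (parabolicReflection b α S.1 i) x) =
        MonoidAlgebra.of ℤ P.weylGroup (simpleReflection b α i) • boundaryGen b α S x := by
    simp only [boundaryGen_apply, Finset.smul_sum]
    refine Finset.sum_congr rfl fun j _ => ?_
    rw [smul_comm, of_smul_chain, mul_one, chain_colorDiffHom_reflection, one_mul]
  obtain ⟨u, hu⟩ := u
  induction hu using Subgroup.closure_induction'' generalizing x with
  | mem y hy =>
    obtain ⟨i, hi, rfl⟩ := hy
    exact refl ⟨i, hi⟩ x
  | inv_mem y hy =>
    obtain ⟨i, hi, rfl⟩ := hy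
    simp only [simpleReflection_inv]
    exact refl ⟨i, hi⟩ x
  | one =>
    rw [map_one, one_smul]
    exact congrArg _ (DFunLike.congr_fun (map_one (diagramRep b α S.1)) x)
  | mul y z hy hz h1 h2 =>
    rw [map_mul, mul_smul, ← h2, ← h1]
    exact congrArg _ (DFunLike.congr_fun
      (map_mul (diagramRep b α S.1) ⟨y, hy⟩ ⟨z, hz⟩) x)

/-- The boundary map on the summand `𝓜(S)`. -/
def boundaryOn {n : ℕ} (S : SubsetOf l (n + 1)) :
    InducedModule b α S.1 →ₗ[MonoidAlgebra ℤ P.weylGroup] Chains b α n :=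
  (balancing b α S.1).liftQ
    (TensorProduct.AlgebraTensorModule.lift
      ((LinearMap.toSpanSingleton (MonoidAlgebra ℤ P.weylGroup)
        ((Diagram S.1 →₀ ℤ) →ₗ[ℤ] Chains b α n) (boundaryGen b α S).toIntLinearMap)))
    (Submodule.span_le.mpr <| by
      rintro _ ⟨a, y, x, rfl⟩
      rw [SetLike.mem_coe, LinearMap.mem_ker, map_sub, sub_eq_zero]
      simp only [TensorProduct.AlgebraTensorModule.lift_tmul, LinearMap.toSpanSingleton_apply,
        LinearMap.smul_apply, mul_smul, AddMonoidHom.coe_toIntLinearMap]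
      congr 1
      -- With `a` stripped off, the balancing relation is additive in `y`, and for a group element
      -- it is the equivariance of `boundaryGen`.
      induction y using MonoidAlgebra.induction_on with
      | of u =>
        simpa [Representation.asAlgebraHom_single] using
          (boundaryGen_diagramRep b α S u x).symm
      | add y z hy hz => rw [map_add, map_add, add_smul, hy, hz, LinearMap.add_apply, map_add]
      | smul m y hy =>
        rw [map_zsmul, smul_assoc, hy, map_zsmul, LinearMap.smul_apply, map_zsmul])

/-- The boundary map `𝓜_{n+1} → 𝓜_n`. -/
def boundary (n : ℕ) :
    Chains b α (n + 1) →ₗ[MonoidAlgebra ℤ P.weylGroup] Chains b α n :=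
  DirectSum.toModule _ _ _ (boundaryOn b α)

lemma boundary_chain {n : ℕ} (S : SubsetOf l (n + 1)) (w : P.weylGroup) (D : Diagram S.1) :
    boundary b α n (chain b α S w (Finsupp.single D 1)) =
      ∑ j : {j : Fin l // j ∉ S.1}, ∑ c ∈ ({1, 2} : Finset ℕ),
        (-1 : ℤ) ^ (position S.1 j + c + 1) •
          chain b α (colorSet S j j.2) w (Finsupp.single (colorDiagram S j c D) 1) := by
  have h : boundary b α n (chain b α S w (Finsupp.single D 1)) =
      MonoidAlgebra.of ℤ P.weylGroup w • boundaryGen b α S (Finsupp.single D 1) :=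
    DirectSum.toModule_lof _ S _
  rw [h, boundaryGen_apply, Finset.smul_sum]
  refine Finset.sum_congr rfl fun j _ => ?_
  rw [smul_comm, of_smul_chain, mul_one]
  rw [colorDiffHom_single, ← chainHom_apply, map_sub, chainHom_apply, chainHom_apply,
    Finset.sum_pair (by decide)]
  -- The sign is $(-1)^p$ for $c=1$ and $-(-1)^p$ for $c=2$, with $p$ the position: the two colors
  -- combine into the difference.
  simp only [pow_add, sub_eq_add_neg]
  simp

lemma isSignedBoundary_boundary :
    IsSignedBoundary b α fun n => (boundary b α n).toAddMonoidHom :=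
  fun _ S w _ D => boundary_chain b α S w D

/-! ### Uniqueness and vanishing of the square -/

lemma chains_addHom_ext {A : Type*} [AddCommGroup A] {n : ℕ} {f g : Chains b α n →+ A}
    (h : ∀ S w, IsMinimalRep b α S.1 w → ∀ D,
      f (chain b α S w (Finsupp.single D 1)) = g (chain b α S w (Finsupp.single D 1))) :
    f = g :=
  DirectSum.addHom_ext' fun S => addHom_ext_of_isMinimalRep b α S.1 (h S)

lemma position_insert {S : Finset (Fin l)} {j : Fin l} (hj : j ∉ S) (k : Fin l) :
    position S k = position (insert j S) k + if j ≤ k then 1 else 0 := by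
  unfold position
  split_ifs with h
  · rw [← Finset.card_insert_of_notMem (a := j) (by simp)]
    congr 1
    ext i
    by_cases hi : i = j
    · simp [hi, hj, h]
    · simp [hi]
  · rw [add_zero]
    congr 1
    ext i
    by_cases hi : i = j
    · simp [hi, h]
    · simp [hi]

/-- Coloring in two orders gives sets that are equal only propositionally, so the diagrams have
different types and are compared through their sign functions. -/
lemma chain_congr {n : ℕ} {S T : SubsetOf l n} (h : S = T) (w : P.weylGroup)
    {D : Diagram S.1} {E : Diagram T.1} (hDE : D.1 = E.1) :
    chain b α S w (Finsupp.single D 1) = chain b α T w (Finsupp.single E 1) := by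
  subst h
  rw [Subtype.ext hDE]

/-- Coloring the smaller vertex lowers the position of the larger one by one, while coloring the
larger leaves the smaller in place. So exactly one position shifts. -/
lemma neg_one_pow_position_swap {S : Finset (Fin l)} {j k : Fin l} (hj : j ∉ S) (hk : k ∉ S)
    (hjk : j ≠ k) (c c' : ℕ) :
    (-1 : ℤ) ^ (position S j + c + 1) * (-1) ^ (position (insert j S) k + c' + 1) =
      -((-1) ^ (position S k + c' + 1) * (-1) ^ (position (insert k S) j + c + 1)) := by
  rw [position_insert hj k, position_insert hk j]
  rcases lt_or_gt_of_ne hjk with h | h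
  · rw [if_pos h.le, if_neg h.not_ge]; ring
  · rw [if_pos h.le, if_neg h.not_ge]; ring

lemma boundary_boundary_chain {n : ℕ} (S : SubsetOf l (n + 2)) (w : P.weylGroup)
    (D : Diagram S.1) :
    boundary b α n (boundary b α (n + 1) (chain b α S w (Finsupp.single D 1))) = 0 := by
  simp only [boundary_chain, map_sum, map_zsmul, Finset.smul_sum, smul_smul]
  -- Both vertex sums move outside both color sums, so that the involution can act on ordered pairs
  -- of vertices.
  simp_rw [Finset.sum_comm (s := ({1, 2} : Finset ℕ)) (t := Finset.univ)]
  rw [Finset.sum_sigma']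
  refine Finset.sum_involution (fun p _ =>
    ⟨⟨p.2.1, fun h => p.2.2 (Finset.mem_insert_of_mem h)⟩,
      ⟨p.1.1, fun h => (Finset.mem_insert.mp h).elim
        (fun h => p.2.2 (h ▸ Finset.mem_insert_self _ _)) p.1.2⟩⟩)
    ?_ ?_ (fun _ _ => Finset.mem_univ _) (fun _ _ => rfl)
  · rintro ⟨⟨j, hj⟩, ⟨k, hk'⟩⟩ -
    have hk : k ∉ S.1 := fun h => hk' (Finset.mem_insert_of_mem h)
    have hjk : j ≠ k := fun h => hk' (h ▸ Finset.mem_insert_self _ _)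
    rw [add_eq_zero_iff_eq_neg, Finset.sum_comm, ← Finset.sum_neg_distrib]
    -- Each color stays with its vertex when the order is exchanged, hence the swap of the two color
    -- sums.
    refine Finset.sum_congr rfl fun c _ => ?_
    rw [← Finset.sum_neg_distrib]
    refine Finset.sum_congr rfl fun c' _ => ?_
    rw [← neg_smul]
    refine congrArg₂ _ (neg_one_pow_position_swap hj hk hjk _ _) (chain_congr b α ?_ w ?_)
    · exact Subtype.ext (Finset.insert_comm _ _ _)
    · exact Function.update_comm hjk _ _ _
  · rintro ⟨⟨j, hj⟩, ⟨k, hk⟩⟩ - - h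
    -- A fixed point would have `k = j`, but `j` is already colored when `k` is chosen.
    exact hk (Finset.mem_insert.mpr (.inl (congrArg (fun p => p.1.1) h)))

lemma boundary_comp_boundary (n : ℕ) : boundary b α n ∘ₗ boundary b α (n + 1) = 0 :=
  LinearMap.toAddMonoidHom_injective <|
    chains_addHom_ext b α fun S w _ D => boundary_boundary_chain b α S w D

end ColoredDynkin

end

theorem proposition3p3p2 {ι V V' : Type*} [AddCommGroup V] [Module ℝ V]
    [AddCommGroup V'] [Module ℝ V'] [Finite ι] (P : RootPairing ι ℝ V V')
    [P.IsRootSystem] [P.IsCrystallographic] [P.IsReduced] (b : P.Base)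
    (l : ℕ) (α : Fin l ≃ b.support) :
    ∃ d : ∀ n : ℕ, ColoredDynkin.Chains b α (n + 1) →ₗ[MonoidAlgebra ℤ P.weylGroup]
        ColoredDynkin.Chains b α n,
      ColoredDynkin.IsSignedBoundary b α (fun n => (d n).toAddMonoidHom) ∧
      (∀ d' : ∀ n : ℕ, ColoredDynkin.Chains b α (n + 1) →+ ColoredDynkin.Chains b α n,
        ColoredDynkin.IsSignedBoundary b α d' → ∀ n, d' n = (d n).toAddMonoidHom) ∧
      ∀ n : ℕ, d n ∘ₗ d (n + 1) = 0 :=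
  ⟨ColoredDynkin.boundary b α, ColoredDynkin.isSignedBoundary_boundary b α,
    fun _ hd' n => ColoredDynkin.chains_addHom_ext b α fun S w hw D =>
      (hd' n S w hw D).trans (ColoredDynkin.boundary_chain b α S w D).symm,
    ColoredDynkin.boundary_comp_boundary b α⟩
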